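/- For $0\le m\le n$ regard $\mathbb{R}^m=\mathbb{R}^m\times 0\subset\mathbb{R}^n$. Let $\mathrm{TOP}_{n,m}$ be the simplicial set whose $k$-simplices are germs near $0\times\Delta^k$ of maps $f\colon U\times\Delta^k\to\mathbb{R}^n\times\Delta^k$, where $U\subset\mathbb{R}^n$ is an open neighbourhood of $0$, which are homeomorphisms onto an open image, commute with the projection to $\Delta^k$ and are the identity on $(U\cap\mathbb{R}^m)\times\Delta^k$; here $f\colon U\times\Delta^k\to\mathbb{R}^n\times\Delta^k$ and $f'\colon U'\times\Delta^k\to\mathbb{R}^n\times\Delta^k$ have the same germ if they agree on $V\times\Delta^k$ for some open $V\subset U\cap U'$ containing $0$, and simplicial operators act by restriction along the affine maps $\Delta^l\to\Delta^k$. Let $\mathrm{PL}_{n,m}\subset\mathrm{TOP}_{n,m}$ be the simplicial subset of the germs that have a piecewise linear representative. Let $\mathrm{O}_1$ denote the simplicial set of continuous singular simplices of the orthogonal group $O(1)=\{\pm1\}$, and let $\iota\colon\mathrm{O}_1\to\mathrm{TOP}_{n,n-1}$ send $\sigma\colon\Delta^k\to O(1)$ to the germ of $(x_1,\dots,x_n,t)\mapsto(x_1,\dots,x_{n-1},\sigma(t)x_n,t)$.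 Then for every $n\ge 1$ one has equivalences of simplicial sets $\mathrm{TOP}_{n,n-1}\simeq\mathrm{O}_1\simeq\mathrm{PL}_{n,n-1}$. More precisely, $\iota$ takes values in $\mathrm{PL}_{n,n-1}$, and both $\iota\colon\mathrm{O}_1\to\mathrm{TOP}_{n,n-1}$ and its corestriction $\mathrm{O}_1\to\mathrm{PL}_{n,n-1}$ are simplicial homotopy equivalences. -/

import Mathlib

open CategoryTheory Topology Filter Set

namespace GermSpace

/-! ### Simplicial homotopy equivalences -/

/-- A map of simplicial sets is a homotopy equivalence if it has an inverse up to simplicial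
homotopies `X ⊗ Δ[1] ⟶ X` and `Y ⊗ Δ[1] ⟶ Y`. -/
def IsHomotopyEquiv {X Y : SSet.{0}} (f : X ⟶ Y) : Prop :=
  ∃ g : Y ⟶ X, Nonempty (SSet.Homotopy (f ≫ g) (𝟙 X)) ∧ Nonempty (SSet.Homotopy (g ≫ f) (𝟙 Y))

/-! ### Piecewise linear maps -/

/-- A (closed convex) polyhedron: a finite intersection of closed affine half-spaces. -/
def IsPolyhedron {V : Type*} [AddCommGroup V] [Module ℝ V] (P : Set V) : Prop :=
  ∃ s : Set ((V →ₗ[ℝ] ℝ) × ℝ), s.Finite ∧ P = {v | ∀ q ∈ s, q.1 v ≤ q.2}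

/-- A map `f : S → W` on a subset `S` of a vector space is piecewise linear if every point of `S`
has a neighbourhood in `S` that is a finite union of polyhedra on each of which `f` is affine.
(Continuity is automatic, since the polyhedra are closed and finitely many.) -/
def IsPL {V W : Type*} [AddCommGroup V] [Module ℝ V] [TopologicalSpace V]
    [AddCommGroup W] [Module ℝ W] {S : Set V} (f : S → W) : Prop :=
  ∀ p : S, ∃ C : Set (Set V), C.Finite ∧
    (∀ P ∈ C, IsPolyhedron P ∧ P ⊆ S ∧ ∃ A : V →ᵃ[ℝ] W, ∀ q : S, q.1 ∈ P → f q = A q.1) ∧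
    {q : S | ∃ P ∈ C, q.1 ∈ P} ∈ 𝓝 p

/-! ### Germs of parametrized homeomorphisms -/

/-- The standard topological simplex `Δᵏ`, inside `ℝᵏ⁺¹`. -/
abbrev Simp (k : ℕ) : Type := stdSimplex ℝ (Fin (k + 1))

/-- The filter of neighbourhoods of `0 × Δᵏ` in `ℝⁿ × Δᵏ` of the form `V × Δᵏ`. -/
abbrev nearZero (n k : ℕ) : Filter ((Fin n → ℝ) × Simp k) := 𝓝 0 ×ˢ ⊤

/-- Germs near `0 × Δᵏ` of maps `ℝⁿ × Δᵏ → ℝⁿ × Δᵏ` over `Δᵏ`. Such a map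
`(x, t) ↦ (F (x, t), t)` is given by its first component `F`. Two maps have the same germ if they
agree on `V × Δᵏ` for some neighbourhood `V` of `0`. -/
abbrev ParamGerm (n k : ℕ) : Type := Germ (nearZero n k) (Fin n → ℝ)

/-- The map `U × Δᵏ → ℝⁿ × Δᵏ`, `(x, t) ↦ (F (x, t), t)`. -/
def overMap {n k : ℕ} (F : (Fin n → ℝ) × Simp k → (Fin n → ℝ)) (U : Set (Fin n → ℝ)) :
    U × Simp k → (Fin n → ℝ) × Simp k :=
  fun p => (F (p.1.1, p.2), p.2)

/-- The first component of `overMap F U`, as a function on the subset `U × Δᵏ` of the vector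
space `ℝⁿ × ℝᵏ⁺¹`. -/
def ambientMap {n k : ℕ} (F : (Fin n → ℝ) × Simp k → (Fin n → ℝ)) (U : Set (Fin n → ℝ)) :
    (U ×ˢ stdSimplex ℝ (Fin (k + 1)) : Set ((Fin n → ℝ) × (Fin (k + 1) → ℝ))) → (Fin n → ℝ) :=
  fun q => F (q.1.1, ⟨q.1.2, q.2.2⟩)

/-- The subspace `ℝᵐ = ℝᵐ × 0` of `ℝⁿ`. -/
def subspace (n m : ℕ) : Set (Fin n → ℝ) := {x | ∀ i : Fin n, m ≤ i.val → x i = 0}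

/-- On `U × Δᵏ`, with `U` an open neighbourhood of `0`, the map `(x, t) ↦ (F (x, t), t)` is a
homeomorphism onto an open subset of `ℝⁿ × Δᵏ`, and it is the identity on `(U ∩ ℝᵐ) × Δᵏ`. -/
structure IsLocalHomeoOn (n m k : ℕ) (F : (Fin n → ℝ) × Simp k → (Fin n → ℝ))
    (U : Set (Fin n → ℝ)) : Prop where
  isOpen : IsOpen U
  zero_mem : (0 : Fin n → ℝ) ∈ U
  isOpenEmbedding : IsOpenEmbedding (overMap F U)
  fixes : ∀ x ∈ U, x ∈ subspace n m → ∀ t, F (x, t) = x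

/-- The `k`-simplices of `TOP_{n,m}`. -/
def IsTopGerm (n m k : ℕ) (g : ParamGerm n k) : Prop :=
  ∃ (F : (Fin n → ℝ) × Simp k → (Fin n → ℝ)) (U : Set (Fin n → ℝ)),
    g = (F : ParamGerm n k) ∧ IsLocalHomeoOn n m k F U

/-- The `k`-simplices of `PL_{n,m}`. -/
def IsPLGerm (n m k : ℕ) (g : ParamGerm n k) : Prop :=
  ∃ (F : (Fin n → ℝ) × Simp k → (Fin n → ℝ)) (U : Set (Fin n → ℝ)),
    g = (F : ParamGerm n k) ∧ IsLocalHomeoOn n m k F U ∧ IsPL (ambientMap F U)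

/-! ### Restriction along maps of simplices -/

/-- The map `ℝⁿ × Δˡ → ℝⁿ × Δᵏ` induced by a map of vertices. -/
noncomputable def baseChange (n : ℕ) {k l : ℕ} (θ : Fin (l + 1) → Fin (k + 1)) :
    (Fin n → ℝ) × Simp l → (Fin n → ℝ) × Simp k :=
  Prod.map id (stdSimplex.map θ)

theorem tendsto_baseChange (n : ℕ) {k l : ℕ} (θ : Fin (l + 1) → Fin (k + 1)) :
    Tendsto (baseChange n θ) (nearZero n l) (nearZero n k) :=
  tendsto_id.prodMap tendsto_top

/-- Restriction of a germ along the map `Δˡ → Δᵏ` induced by a map of vertices. -/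
noncomputable def restrict {n k l : ℕ} (θ : Fin (l + 1) → Fin (k + 1)) (g : ParamGerm n k) :
    ParamGerm n l :=
  g.compTendsto (baseChange n θ) (tendsto_baseChange n θ)

theorem restrict_id {n k : ℕ} (g : ParamGerm n k) : restrict id g = g := by
  induction g using Germ.inductionOn with
  | _ F =>
    have h : baseChange n (id : Fin (k + 1) → Fin (k + 1)) = id := by
      funext p
      exact Prod.ext rfl (stdSimplex.map_id_apply p.2)
    simp [restrict, h]

theorem restrict_comp {n k l j : ℕ} (θ : Fin (l + 1) → Fin (k + 1)) (η : Fin (j + 1) → Fin (l + 1))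
    (g : ParamGerm n k) : restrict (θ ∘ η) g = restrict η (restrict θ g) := by
  induction g using Germ.inductionOn with
  | _ F =>
    have h : baseChange n (θ ∘ η) = baseChange n θ ∘ baseChange n η := by
      funext p
      exact Prod.ext rfl (stdSimplex.map_comp_apply η θ p.2).symm
    simp [restrict, h, Function.comp_assoc]

theorem IsLocalHomeoOn.baseChange {n m k l : ℕ} {F : (Fin n → ℝ) × Simp k → (Fin n → ℝ)}
    {U : Set (Fin n → ℝ)} (h : IsLocalHomeoOn n m k F U) (θ : Fin (l + 1) → Fin (k + 1)) :
    IsLocalHomeoOn n m l (F ∘ GermSpace.baseChange n θ) U := by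
  refine ⟨h.isOpen, h.zero_mem, ?_, fun x hx hm t => h.fixes x hx hm _⟩
  have hθ : Continuous (stdSimplex.map (S := ℝ) θ) := stdSimplex.continuous_map θ
  have hF : Continuous fun p : U × Simp k => F (p.1.1, p.2) :=
    continuous_fst.comp h.isOpenEmbedding.continuous
  have hcont : Continuous (overMap (F ∘ GermSpace.baseChange n θ) U) := by
    refine Continuous.prodMk ?_ continuous_snd
    exact hF.comp (continuous_fst.prodMk (hθ.comp continuous_snd))
  have hgr : ∀ {X : Type} [TopologicalSpace X],
      IsEmbedding (fun p : X × Simp l => ((p.1, stdSimplex.map (S := ℝ) θ p.2), p.2)) := by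
    intro X _
    exact IsEmbedding.of_leftInverse (f := fun q : (X × Simp k) × Simp l => (q.1.1, q.2))
      (fun _ => rfl) (by fun_prop) (by fun_prop)
  have hE : IsEmbedding (overMap (F ∘ GermSpace.baseChange n θ) U) := by
    have h1 := (h.isOpenEmbedding.isEmbedding.prodMap
      (IsEmbedding.id (X := Simp l))).comp (hgr (X := U))
    have h2 : Continuous (fun p : (Fin n → ℝ) × Simp l =>
      ((p.1, stdSimplex.map (S := ℝ) θ p.2), p.2)) := by fun_prop
    exact IsEmbedding.of_comp hcont h2 h1
  refine ⟨hE, ?_⟩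
  have hr : range (overMap (F ∘ GermSpace.baseChange n θ) U) =
      (fun p : (Fin n → ℝ) × Simp l => (p.1, stdSimplex.map (S := ℝ) θ p.2)) ⁻¹'
        range (overMap F U) := by
    ext ⟨y, s⟩
    constructor
    · rintro ⟨⟨x, t⟩, hx⟩
      obtain ⟨hx1, hx2⟩ := Prod.ext_iff.1 hx
      obtain rfl : t = s := hx2
      exact ⟨(x, stdSimplex.map θ t), Prod.ext hx1 rfl⟩
    · rintro ⟨⟨x, t⟩, hx⟩
      obtain ⟨hx1, hx2⟩ := Prod.ext_iff.1 hx
      obtain rfl : t = stdSimplex.map θ s := hx2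
      exact ⟨(x, s), Prod.ext hx1 rfl⟩
  rw [hr]
  exact h.isOpenEmbedding.isOpen_range.preimage (by fun_prop)

theorem IsPolyhedron.preimage {V W : Type*} [AddCommGroup V] [Module ℝ V] [AddCommGroup W]
    [Module ℝ W] {P : Set W} (h : IsPolyhedron P) (L : V →ₗ[ℝ] W) : IsPolyhedron (L ⁻¹' P) := by
  obtain ⟨s, hs, rfl⟩ := h
  refine ⟨(fun q => (q.1.comp L, q.2)) '' s, hs.image _, ?_⟩
  ext v
  simp only [mem_preimage, mem_ofPred_eq, forall_mem_image, LinearMap.comp_apply]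

theorem IsPolyhedron.inter {V : Type*} [AddCommGroup V] [Module ℝ V] {P Q : Set V}
    (hP : IsPolyhedron P) (hQ : IsPolyhedron Q) : IsPolyhedron (P ∩ Q) := by
  obtain ⟨s, hs, rfl⟩ := hP
  obtain ⟨t, ht, rfl⟩ := hQ
  refine ⟨s ∪ t, hs.union ht, ?_⟩
  ext v
  simp only [mem_inter_iff, mem_ofPred_eq, mem_union]
  exact ⟨fun h q hq => hq.elim (h.1 q) (h.2 q), fun h => ⟨fun q hq => h q (.inl hq),
    fun q hq => h q (.inr hq)⟩⟩

theorem isPolyhedron_stdSimplex (k : ℕ) : IsPolyhedron (stdSimplex ℝ (Fin (k + 1))) := by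
  refine ⟨range (fun i => (-LinearMap.proj i, 0)) ∪
    {(∑ i, LinearMap.proj i, 1), (-∑ i, LinearMap.proj i, -1)},
    (finite_range _).union (by simp), ?_⟩
  ext v
  simp only [stdSimplex, mem_ofPred_eq, mem_union, mem_range, mem_insert_iff, mem_singleton_iff]
  constructor
  · rintro ⟨h0, h1⟩ q (⟨i, rfl⟩ | rfl | rfl)
    · simpa using h0 i
    · simp [h1]
    · simp [h1]
  · intro h
    refine ⟨fun i => ?_, le_antisymm ?_ ?_⟩
    · simpa using h _ (.inl ⟨i, rfl⟩)
    · simpa using h _ (.inr (.inl rfl))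
    · simpa using h _ (.inr (.inr rfl))

theorem isPL_baseChange {n k l : ℕ} {F : (Fin n → ℝ) × Simp k → (Fin n → ℝ)}
    {U : Set (Fin n → ℝ)} (h : IsPL (ambientMap F U)) (θ : Fin (l + 1) → Fin (k + 1)) :
    IsPL (ambientMap (F ∘ baseChange n θ) U) := by
  intro p
  let L : ((Fin n → ℝ) × (Fin (l + 1) → ℝ)) →ₗ[ℝ] ((Fin n → ℝ) × (Fin (k + 1) → ℝ)) :=
    LinearMap.prodMap LinearMap.id (FunOnFinite.linearMap ℝ ℝ θ)
  have hmap : ∀ s : Simp l, FunOnFinite.linearMap ℝ ℝ θ s.1 = (stdSimplex.map θ s).1 :=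
    fun s => rfl
  let Φ : (U ×ˢ stdSimplex ℝ (Fin (l + 1)) : Set ((Fin n → ℝ) × (Fin (l + 1) → ℝ))) →
      (U ×ˢ stdSimplex ℝ (Fin (k + 1)) : Set ((Fin n → ℝ) × (Fin (k + 1) → ℝ))) :=
    fun q => ⟨L q.1, q.2.1, (stdSimplex.map θ ⟨q.1.2, q.2.2⟩).2⟩
  have hΦ : Continuous Φ := by
    have hL : Continuous L := L.continuous_of_finiteDimensional
    exact Continuous.subtype_mk (hL.comp continuous_subtype_val) _
  obtain ⟨C, hC, hP, hn⟩ := h (Φ p)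
  refine ⟨(fun P => L ⁻¹' P ∩ (LinearMap.snd ℝ (Fin n → ℝ) (Fin (l + 1) → ℝ)) ⁻¹'
    stdSimplex ℝ (Fin (l + 1))) '' C, hC.image _, ?_, ?_⟩
  · rintro _ ⟨P, hPC, rfl⟩
    obtain ⟨hp, hsub, A, hA⟩ := hP P hPC
    refine ⟨(hp.preimage L).inter ((isPolyhedron_stdSimplex l).preimage _), ?_,
      A.comp L.toAffineMap, ?_⟩
    · rintro v ⟨hv1, hv2⟩
      exact ⟨(hsub hv1).1, hv2⟩
    · rintro q ⟨hq, -⟩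
      exact hA (Φ q) hq
  · filter_upwards [hΦ.continuousAt.preimage_mem_nhds hn] with q hq
    obtain ⟨P, hPC, hq⟩ := hq
    exact ⟨_, ⟨P, hPC, rfl⟩, hq, q.2.2⟩

/-! ### The simplicial sets `TOP_{n,m}` and `PL_{n,m}` -/

/-- The simplicial set `TOP_{n,m}`: its `k`-simplices are the germs near `0 × Δᵏ` of
homeomorphisms of `ℝⁿ × Δᵏ` over `Δᵏ` that are the identity on `ℝᵐ × Δᵏ`. -/
noncomputable def TOP (n m : ℕ) : SSet.{0} where
  obj k := {g : ParamGerm n k.unop.len // IsTopGerm n m k.unop.len g}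
  map θ := ↾fun g => ⟨restrict θ.unop.toOrderHom g.1, by
    obtain ⟨_, F, U, rfl, h⟩ := g
    exact ⟨_, U, rfl, h.baseChange θ.unop.toOrderHom⟩⟩
  map_id k := by
    ext g
    exact restrict_id g.1
  map_comp θ η := by
    ext g
    exact restrict_comp θ.unop.toOrderHom η.unop.toOrderHom g.1

/-- The simplicial subset `PL_{n,m}` of `TOP_{n,m}`, of germs of PL homeomorphisms. -/
def PL (n m : ℕ) : (TOP n m).Subcomplex where
  obj k := {g | IsPLGerm n m k.unop.len g.1}
  map θ := by
    rintro ⟨_, -⟩ ⟨F, U, rfl, h, hpl⟩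
    exact ⟨_, U, rfl, h.baseChange θ.unop.toOrderHom, isPL_baseChange hpl θ.unop.toOrderHom⟩

/-! ### The orthogonal group and its action on the last coordinate -/

/-- The simplicial set of continuous singular simplices of the topological group `O(1)`. -/
noncomputable def O1 : SSet.{0} :=
  TopCat.toSSet.obj (TopCat.of (Matrix.orthogonalGroup (Fin 1) ℝ))

/-- The linear map of `ℝⁿ` that acts by `a ∈ O(1)` on the last coordinate and fixes the others. -/
def actLast (n : ℕ) (a : Matrix.orthogonalGroup (Fin 1) ℝ) (x : Fin n → ℝ) : Fin n → ℝ :=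
  fun i => if i.val + 1 = n then a.1 0 0 * x i else x i

theorem actLast_actLast (n : ℕ) (a : Matrix.orthogonalGroup (Fin 1) ℝ) (x : Fin n → ℝ) :
    actLast n a (actLast n a x) = x := by
  have h : a.1 0 0 * a.1 0 0 = 1 := by
    have := congrFun (congrFun ((Matrix.mem_orthogonalGroup_iff _ _).1 a.2) 0) 0
    simpa [Matrix.mul_apply] using this
  funext i
  by_cases hi : i.val + 1 = n
  · simp [actLast, hi, ← mul_assoc, h]
  · simp [actLast, hi]

/-- The map `(x, t) ↦ σ(t) x` given by a singular simplex `σ` of `O(1)`. -/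
def actFamily (n : ℕ) {k : ℕ} (σ : C(Simp k, Matrix.orthogonalGroup (Fin 1) ℝ)) :
    (Fin n → ℝ) × Simp k → (Fin n → ℝ) :=
  fun p => actLast n (σ p.2) p.1

theorem isLocalHomeoOn_actFamily (n : ℕ) {k : ℕ}
    (σ : C(Simp k, Matrix.orthogonalGroup (Fin 1) ℝ)) :
    IsLocalHomeoOn n (n - 1) k (actFamily n σ) univ := by
  refine ⟨isOpen_univ, mem_univ _, ?_, ?_⟩
  · have hc : Continuous (actFamily n σ) := by
      refine continuous_pi fun i => ?_
      by_cases hi : i.val + 1 = n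
      · simp only [actFamily, actLast, hi, if_true]
        have : Continuous fun p : (Fin n → ℝ) × Simp k => (σ p.2).1 :=
          continuous_subtype_val.comp (σ.continuous.comp continuous_snd)
        exact (this.matrix_elem 0 0).mul ((continuous_apply i).comp continuous_fst)
      · simp only [actFamily, actLast, hi, if_false]
        exact (continuous_apply i).comp continuous_fst
    let e : (Fin n → ℝ) × Simp k ≃ₜ (Fin n → ℝ) × Simp k :=
      { toFun := fun p => (actFamily n σ p, p.2)
        invFun := fun p => (actFamily n σ p, p.2)
        left_inv := fun p => Prod.ext (actLast_actLast n (σ p.2) p.1) rfl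
        right_inv := fun p => Prod.ext (actLast_actLast n (σ p.2) p.1) rfl
        continuous_toFun := hc.prodMk continuous_snd
        continuous_invFun := hc.prodMk continuous_snd }
    exact e.isOpenEmbedding.comp
      ((Homeomorph.Set.univ _).isOpenEmbedding.prodMap IsOpenEmbedding.id)
  · intro x _ hx t
    funext i
    by_cases hi : i.val + 1 = n
    · have : x i = 0 := hx i (by omega)
      simp [actFamily, actLast, this]
    · simp [actFamily, actLast, hi]

/-- The inclusion `O₁ → TOP_{n,n-1}` sending a singular simplex `σ` to the germ of
`(x, t) ↦ (σ(t) x, t)`, where `O(1)` acts on the last coordinate of `ℝⁿ`. -/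
noncomputable def O1toTOP (n : ℕ) : O1 ⟶ TOP n (n - 1) where
  app k := ↾fun σ => ⟨(actFamily n (TopCat.toSSetObjEquiv _ k σ) : ParamGerm n k.unop.len),
    _, univ, rfl, isLocalHomeoOn_actFamily n _⟩
  naturality k l θ := by
    ext σ
    rfl

end GermSpace

/-!
A germ in `TOP_{n,n-1}` fixes the hyperplane `xₙ = 0`, so by injectivity it maps no other point near
`0` into the hyperplane. By connectedness of the two half balls times `Δᵏ`, and because the image is
a neighbourhood of `0 × Δᵏ`, it either preserves or exchanges the two sides of the hyperplane
(`IsLocalHomeoOn.exists_sign`). This sign is a retraction `TOPtoO1` of `ι : O₁ → TOP_{n,n-1}`.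

The composite of the retraction and `ι` is homotopic to the identity by an explicit natural
deformation. Cut `ℝⁿ` along the hyperplane and insert a slab `|xₙ| ≤ s`; let the germ act on
the outside of the slab, translated by `±s`, and the sign `a` act on the slab by `xₙ ↦ a xₙ`
(`insertSlab`). Since the germ fixes the hyperplane this is again a local homeomorphism. With `c` the
projection of `xₙ` to `[-s, s]`, the formula is `x ↦ F(x - c eₙ) + a c eₙ`. For `s = 0` this is `F`,
and for `s = 1` it is, near `0`, the linear map `ι(a)`. Over a simplex of `TOP_{n,n-1} ⊗ Δ[1]` the
width `s` is the affine function on `Δᵏ` given by the `Δ[1]`-component (`weight`), which makes the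
construction simplicial. As the width is affine and `c` is piecewise linear in `(x, s)`, piecewise
linear germs remain so (`isPL_insertSlab`), and the same deformation proves the PL case.
-/

namespace GermSpace

/-! ### The sign of a germ -/

theorem pos_or_neg_of_isPreconnected {X : Type*} [TopologicalSpace X] {S : Set X}
    (hS : _root_.IsPreconnected S) {f : X → ℝ} (hf : ContinuousOn f S) (h0 : ∀ p ∈ S, f p ≠ 0) :
    (∀ p ∈ S, 0 < f p) ∨ ∀ p ∈ S, f p < 0 := by
  by_contra! h
  obtain ⟨⟨p, hp, hp'⟩, q, hq, hq'⟩ := h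
  obtain ⟨r, hr, hr'⟩ := hS.intermediate_value hp hq hf ⟨hp', hq'⟩
  exact h0 r hr hr'

theorem mem_subspace_iff {n : ℕ} {e : Fin n} (he : e.val + 1 = n) {x : Fin n → ℝ} :
    x ∈ subspace n (n - 1) ↔ x e = 0 := by
  constructor
  · intro h
    exact h e (by omega)
  · intro h i hi
    obtain rfl : i = e := Fin.ext (by omega)
    exact h

namespace IsLocalHomeoOn

variable {n m k : ℕ} {F : (Fin n → ℝ) × Simp k → (Fin n → ℝ)} {U : Set (Fin n → ℝ)}

theorem continuousOn (h : IsLocalHomeoOn n m k F U) : ContinuousOn F (U ×ˢ univ) := by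
  rw [continuousOn_iff_continuous_domRestrict]
  have h1 : Continuous fun p : U × Simp k => F (p.1.1, p.2) :=
    continuous_fst.comp h.isOpenEmbedding.continuous
  have h2 : Continuous fun p : (U ×ˢ univ : Set ((Fin n → ℝ) × Simp k)) =>
      ((⟨p.1.1, p.2.1⟩, p.1.2) : U × Simp k) := by fun_prop
  exact h1.comp h2

theorem eq_of_apply_eq (h : IsLocalHomeoOn n m k F U) {x y : Fin n → ℝ} (hx : x ∈ U) (hy : y ∈ U)
    {t : Simp k} (hxy : F (x, t) = F (y, t)) : x = y := by
  have := h.isOpenEmbedding.injective (a₁ := (⟨x, hx⟩, t)) (a₂ := (⟨y, hy⟩, t))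
    (Prod.ext hxy rfl)
  exact congrArg (fun p : U × Simp k => p.1.1) this

theorem apply_zero (h : IsLocalHomeoOn n m k F U) (t : Simp k) : F (0, t) = 0 :=
  h.fixes 0 h.zero_mem (fun _ _ => rfl) t

/-- By compactness of `Δᵏ`, a small ball around `0` is mapped into `U` for all parameters. -/
theorem exists_ball_mapsTo (h : IsLocalHomeoOn n m k F U) :
    ∃ r > 0, Metric.ball 0 r ⊆ U ∧ ∀ x ∈ Metric.ball 0 r, ∀ t, F (x, t) ∈ U := by
  have hO : IsOpen ((U ×ˢ univ) ∩ F ⁻¹' U) :=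
    h.continuousOn.isOpen_inter_preimage (h.isOpen.prod isOpen_univ) h.isOpen
  have hsub : ({0} : Set (Fin n → ℝ)) ×ˢ (univ : Set (Simp k)) ⊆ (U ×ˢ univ) ∩ F ⁻¹' U := by
    rintro ⟨x, t⟩ ⟨hx, -⟩
    obtain rfl : x = 0 := hx
    exact ⟨⟨h.zero_mem, mem_univ _⟩, by simpa [h.apply_zero t] using h.zero_mem⟩
  obtain ⟨u, v, hu, -, h0, hv, huv⟩ :=
    generalized_tube_lemma isCompact_singleton isCompact_univ hO hsub
  obtain ⟨r, hr, hru⟩ := Metric.isOpen_iff.1 hu 0 (h0 rfl)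
  let t₀ : Simp k := stdSimplex.vertex 0
  exact ⟨r, hr, fun x hx => (huv (mk_mem_prod (hru hx) (hv (mem_univ t₀)))).1.1,
    fun x hx t => (huv (mk_mem_prod (hru hx) (hv (mem_univ t)))).2⟩

/-- On a small ball every coordinate of `F` takes all values near `0`, because the image of
the local homeomorphism is a neighbourhood of `0 × Δᵏ`. -/
theorem exists_coord_eq (h : IsLocalHomeoOn n m k F U) {r : ℝ} (hr : 0 < r)
    (e : Fin n) :
    ∃ δ > 0, ∀ s : ℝ, |s| < δ → ∃ x ∈ Metric.ball (0 : Fin n → ℝ) r, ∃ t : Simp k,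
      F (x, t) e = s := by
  let t₀ : Simp k := stdSimplex.vertex 0
  have hopen : IsOpen (overMap F U '' ((fun p : U × Simp k => p.1.1) ⁻¹' Metric.ball 0 r)) :=
    h.isOpenEmbedding.isOpenMap _ (Metric.isOpen_ball.preimage (by fun_prop))
  have hc : Continuous fun s : ℝ => ((Pi.single e s : Fin n → ℝ), t₀) :=
    (continuous_single (A := fun _ : Fin n => ℝ) e).prodMk continuous_const
  obtain ⟨δ, hδ, hsub⟩ := Metric.isOpen_iff.1 (hopen.preimage hc) 0
    ⟨(⟨0, h.zero_mem⟩, t₀), by simpa using hr, by simp [overMap, h.apply_zero]⟩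
  refine ⟨δ, hδ, fun s hs => ?_⟩
  obtain ⟨⟨x, t⟩, hx, hxs⟩ := hsub (show s ∈ Metric.ball 0 δ by simpa using hs)
  refine ⟨x, hx, t, ?_⟩
  have := congrArg (fun p : (Fin n → ℝ) × Simp k => p.1 e) hxs
  simpa [overMap] using this

/-- A local homeomorphism that fixes the hyperplane `ℝⁿ⁻¹` near `0` either preserves or exchanges
its two sides. On each half ball the last component of `F` has no zero, hence a constant sign, and
the two signs differ since the image contains a neighbourhood of `0`. -/
theorem exists_sign (h : IsLocalHomeoOn n (n - 1) k F U) {e : Fin n} (he : e.val + 1 = n) :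
    ∃ a : ℝ, (a = 1 ∨ a = -1) ∧ ∃ r > 0, Metric.ball 0 r ⊆ U ∧
      ∀ x ∈ Metric.ball 0 r, ∀ t, SignType.sign (F (x, t) e) = SignType.sign (a * x e) := by
  obtain ⟨r, hr, hrU, hrF⟩ := h.exists_ball_mapsTo
  obtain ⟨δ, hδ, hsurj⟩ := h.exists_coord_eq hr e
  have hne : ∀ x ∈ Metric.ball 0 r, x e ≠ 0 → ∀ t, F (x, t) e ≠ 0 := by
    intro x hx hxe t hF
    have h1 := h.fixes _ (hrF x hx t) ((mem_subspace_iff he).2 hF) t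
    rw [h.eq_of_apply_eq (hrF x hx t) (hrU hx) h1] at hF
    exact hxe hF
  have hfix : ∀ x ∈ Metric.ball 0 r, x e = 0 → ∀ t, F (x, t) e = 0 := by
    intro x hx hxe t
    rw [h.fixes x (hrU hx) ((mem_subspace_iff he).2 hxe) t, hxe]
  have hside : ∀ H : Set ℝ, Convex ℝ H → 0 ∉ H →
      (∀ x ∈ Metric.ball 0 r, x e ∈ H → ∀ t, 0 < F (x, t) e) ∨
      ∀ x ∈ Metric.ball 0 r, x e ∈ H → ∀ t, F (x, t) e < 0 := by
    intro H hH h0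
    have hpre : _root_.IsPreconnected ((Metric.ball (0 : Fin n → ℝ) r ∩ (fun x => x e) ⁻¹' H) ×ˢ
        (univ : Set (Simp k))) := by
      refine _root_.IsPreconnected.prod ?_ isPreconnected_univ
      exact ((convex_ball _ _).inter
        (hH.linear_preimage (LinearMap.proj (φ := fun _ : Fin n => ℝ) e))).isPreconnected
    have hcont : ContinuousOn (fun p => F p e) ((Metric.ball (0 : Fin n → ℝ) r ∩
        (fun x => x e) ⁻¹' H) ×ˢ (univ : Set (Simp k))) :=
      ((continuous_apply e).comp_continuousOn h.continuousOn).mono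
        (prod_mono (inter_subset_left.trans hrU) le_rfl)
    refine (pos_or_neg_of_isPreconnected hpre hcont ?_).imp ?_ ?_
    · rintro ⟨x, t⟩ ⟨⟨hx, hxH⟩, -⟩
      exact hne x hx (fun h => h0 (h ▸ hxH)) t
    · exact fun hp x hx hxH t => hp (x, t) ⟨⟨hx, hxH⟩, mem_univ _⟩
    · exact fun hp x hx hxH t => hp (x, t) ⟨⟨hx, hxH⟩, mem_univ _⟩
  obtain ⟨x₁, hx₁, t₁, h₁⟩ := hsurj (δ / 2) (by rw [abs_of_pos] <;> linarith)
  obtain ⟨x₂, hx₂, t₂, h₂⟩ := hsurj (-(δ / 2)) (by rw [abs_neg, abs_of_pos] <;> linarith)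
  rcases hside (Ioi 0) (convex_Ioi 0) (by simp) with hp | hp <;>
    rcases hside (Iio 0) (convex_Iio 0) (by simp) with hn | hn
  · rcases lt_trichotomy (x₂ e) 0 with h3 | h3 | h3
    · linarith [hn x₂ hx₂ h3 t₂]
    · linarith [hfix x₂ hx₂ h3 t₂]
    · linarith [hp x₂ hx₂ h3 t₂]
  · refine ⟨1, .inl rfl, r, hr, hrU, fun x hx t => ?_⟩
    rw [one_mul]
    rcases lt_trichotomy (x e) 0 with h3 | h3 | h3
    · rw [sign_neg h3, sign_neg (hn x hx h3 t)]
    · rw [h3, hfix x hx h3 t]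
    · rw [sign_pos h3, sign_pos (hp x hx h3 t)]
  · refine ⟨-1, .inr rfl, r, hr, hrU, fun x hx t => ?_⟩
    rcases lt_trichotomy (x e) 0 with h3 | h3 | h3
    · rw [sign_pos (show 0 < -1 * x e by linarith), sign_pos (hn x hx h3 t)]
    · rw [h3, hfix x hx h3 t, mul_zero]
    · rw [sign_neg (show -1 * x e < 0 by linarith), sign_neg (hp x hx h3 t)]
  · rcases lt_trichotomy (x₁ e) 0 with h3 | h3 | h3
    · linarith [hn x₁ hx₁ h3 t₁]
    · linarith [hfix x₁ hx₁ h3 t₁]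
    · linarith [hp x₁ hx₁ h3 t₁]

end IsLocalHomeoOn

/-! ### Opening up the hyperplane -/

/-- The projection of the coordinate `x_e` to the interval `[-s, s]`, for `s ≥ 0`. -/
def clampCoord {n : ℕ} (e : Fin n) (s : ℝ) (x : Fin n → ℝ) : ℝ := max (-s) (min s (x e))

/-- The map that collapses the slab `|x_e| ≤ s` onto the hyperplane `x_e = 0` and translates the
two sides of the slab by `∓ s`. -/
noncomputable def collapse {n : ℕ} (e : Fin n) (s : ℝ) (x : Fin n → ℝ) : Fin n → ℝ :=
  x - Pi.single e (clampCoord e s x)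

/-- The maps `F(·, t)`, performed outside of the slab `|x_e| ≤ w(t)` in place of the hyperplane
`x_e = 0`, and extended over the slab by `a` on the coordinate `x_e`. -/
noncomputable def insertSlab {n k : ℕ} (e : Fin n) (a : ℝ) (w : Simp k → ℝ)
    (F : (Fin n → ℝ) × Simp k → (Fin n → ℝ)) (p : (Fin n → ℝ) × Simp k) : Fin n → ℝ :=
  F (collapse e (w p.2) p.1, p.2) + Pi.single e (a * clampCoord e (w p.2) p.1)

/-- The relation between the `e`-coordinate `u` of `collapse e s x` and `c = clampCoord e s x`.
It characterizes the pairs `(u, c)` that arise in this way from some `x`. -/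
def IsSlabPair (s u c : ℝ) : Prop := |c| ≤ s ∧ (0 < u → c = s) ∧ (u < 0 → c = -s)

theorem collapse_apply {n : ℕ} (e : Fin n) (s : ℝ) (x : Fin n → ℝ) :
    collapse e s x e = x e - clampCoord e s x := by
  simp [collapse]

theorem collapse_add_single {n : ℕ} (e : Fin n) (s : ℝ) (x : Fin n → ℝ) :
    collapse e s x + Pi.single e (clampCoord e s x) = x := by
  simp [collapse]

theorem isSlabPair_collapse {n : ℕ} (e : Fin n) {s : ℝ} (hs : 0 ≤ s) (x : Fin n → ℝ) :
    IsSlabPair s (collapse e s x e) (clampCoord e s x) := by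
  rw [collapse_apply, clampCoord]
  refine ⟨abs_le.2 ⟨le_max_left _ _, max_le (by linarith) (min_le_left _ _)⟩, ?_, ?_⟩ <;>
  · intro h
    rcases max_cases (-s) (min s (x e)) with h1 | h1 <;>
      rcases min_cases s (x e) with h2 | h2 <;> linarith

theorem IsSlabPair.clampCoord_add {n : ℕ} {e : Fin n} {s c : ℝ} {u : Fin n → ℝ}
    (h : IsSlabPair s (u e) c) : clampCoord e s (u + Pi.single e c) = c := by
  obtain ⟨h1, h2, h3⟩ := h
  rw [abs_le] at h1
  simp only [clampCoord, Pi.add_apply, Pi.single_eq_same]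
  rcases lt_trichotomy (u e) 0 with h | h | h
  · rw [min_eq_right (by linarith), max_eq_left (by linarith [h3 h]), h3 h]
  · rw [h, zero_add, min_eq_right h1.2, max_eq_right h1.1]
  · rw [min_eq_left (by linarith [h2 h]), max_eq_right (by linarith), h2 h]

theorem IsSlabPair.collapse_add {n : ℕ} {e : Fin n} {s c : ℝ} {u : Fin n → ℝ}
    (h : IsSlabPair s (u e) c) : collapse e s (u + Pi.single e c) = u := by
  simp [collapse, h.clampCoord_add]

theorem IsSlabPair.mul {a s u v c : ℝ} (ha : a = 1 ∨ a = -1)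
    (hv : SignType.sign v = SignType.sign (a * u)) (h : IsSlabPair s u c) :
    IsSlabPair s v (a * c) := by
  obtain ⟨h1, h2, h3⟩ := h
  refine ⟨by rcases ha with rfl | rfl <;> simpa using h1, fun hv0 => ?_, fun hv0 => ?_⟩
  · rw [sign_pos hv0, eq_comm, sign_eq_one_iff] at hv
    rcases ha with rfl | rfl
    · rw [one_mul, h2 (by linarith)]
    · rw [h3 (by linarith)]; ring
  · rw [sign_neg hv0, eq_comm, sign_eq_neg_one_iff] at hv
    rcases ha with rfl | rfl
    · rw [one_mul, h3 (by linarith)]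
    · rw [h2 (by linarith)]; ring

theorem norm_collapse_le {n : ℕ} (e : Fin n) {s : ℝ} (hs : 0 ≤ s) (x : Fin n → ℝ) :
    ‖collapse e s x‖ ≤ ‖x‖ := by
  refine (pi_norm_le_iff_of_nonneg (norm_nonneg x)).2 fun i => ?_
  rcases eq_or_ne i e with rfl | hi
  · refine le_trans ?_ (norm_le_pi_norm x i)
    rw [collapse_apply, clampCoord, Real.norm_eq_abs, Real.norm_eq_abs, abs_le]
    rcases max_cases (-s) (min s (x i)) with h1 | h1 <;>
      rcases min_cases s (x i) with h2 | h2 <;>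
      constructor <;> rcases abs_cases (x i) with h3 | h3 <;> linarith
  · simpa [collapse, hi] using norm_le_pi_norm x i

theorem collapse_zero {n : ℕ} (e : Fin n) (x : Fin n → ℝ) : collapse e 0 x = x := by
  have : clampCoord e 0 x = 0 := by
    rcases le_total 0 (x e) with h | h <;> simp [clampCoord, h]
  simp [collapse, this]

theorem clampCoord_of_abs_le {n : ℕ} {e : Fin n} {s : ℝ} {x : Fin n → ℝ} (h : |x e| ≤ s) :
    clampCoord e s x = x e := by
  rw [abs_le] at h
  rw [clampCoord, min_eq_right h.2, max_eq_right h.1]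

theorem continuous_clampCoord {n k : ℕ} (e : Fin n) {w : Simp k → ℝ} (hw : Continuous w) :
    Continuous fun p : (Fin n → ℝ) × Simp k => clampCoord e (w p.2) p.1 := by
  unfold clampCoord
  fun_prop

theorem continuous_collapse {n k : ℕ} (e : Fin n) {w : Simp k → ℝ} (hw : Continuous w) :
    Continuous fun p : (Fin n → ℝ) × Simp k => collapse e (w p.2) p.1 :=
  continuous_fst.sub ((continuous_single e).comp (continuous_clampCoord e hw))

/-- Inserting a slab preserves local homeomorphisms. The map `x ↦ (collapse x, clampCoord x)` is an
embedding into `ℝⁿ × ℝ`, along which `insertSlab e a w F` is the restriction of `F × a`; its image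
is characterized by `IsSlabPair`, and `F × a` maps exactly the image to the image, as
`F` acts by the sign `a` on the two sides of the hyperplane. -/
theorem IsLocalHomeoOn.insertSlab {n k : ℕ} {F : (Fin n → ℝ) × Simp k → (Fin n → ℝ)}
    {U : Set (Fin n → ℝ)} (h : IsLocalHomeoOn n (n - 1) k F U) {e : Fin n} (he : e.val + 1 = n)
    {a : ℝ} (ha : a = 1 ∨ a = -1) {r : ℝ} (hr : 0 < r) (hrU : Metric.ball 0 r ⊆ U)
    (hsign : ∀ x ∈ Metric.ball 0 r, ∀ t, SignType.sign (F (x, t) e) = SignType.sign (a * x e))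
    {w : Simp k → ℝ} (hw : Continuous w) (hw0 : ∀ t, 0 ≤ w t) :
    IsLocalHomeoOn n (n - 1) k (insertSlab e a w F) (Metric.ball 0 r) := by
  have ha2 : a * a = 1 := by rcases ha with rfl | rfl <;> norm_num
  have hcl := continuous_clampCoord e hw
  have hco := continuous_collapse e hw
  have hmem : ∀ (x : Metric.ball (0 : Fin n → ℝ) r) (t : Simp k),
      collapse e (w t) x.1 ∈ Metric.ball (0 : Fin n → ℝ) r := fun x t => by
    have := x.2
    rw [mem_ball_zero_iff] at this ⊢
    exact (norm_collapse_le e (hw0 t) _).trans_lt this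
  -- the embedding, on all of `ℝⁿ` and on the ball, and the map `F × a`
  let j : (Fin n → ℝ) × Simp k → ((Fin n → ℝ) × Simp k) × ℝ := fun p =>
    ((collapse e (w p.2) p.1, p.2), clampCoord e (w p.2) p.1)
  let j' : Metric.ball (0 : Fin n → ℝ) r × Simp k → (Metric.ball (0 : Fin n → ℝ) r × Simp k) × ℝ :=
    fun p => ((⟨collapse e (w p.2) p.1, hmem p.1 p.2⟩, p.2), clampCoord e (w p.2) p.1)
  let Φ : (Metric.ball (0 : Fin n → ℝ) r × Simp k) × ℝ → ((Fin n → ℝ) × Simp k) × ℝ :=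
    Prod.map (overMap F (Metric.ball 0 r)) (fun c => a * c)
  have hj : IsEmbedding j := IsEmbedding.of_leftInverse
    (f := fun q : ((Fin n → ℝ) × Simp k) × ℝ => (q.1.1 + Pi.single e q.2, q.1.2))
    (fun p => Prod.ext (collapse_add_single e (w p.2) p.1) rfl)
    (((continuous_fst.comp continuous_fst).add ((continuous_single e).comp continuous_snd)).prodMk
      (by fun_prop)) (by fun_prop)
  have hval : Continuous fun p : Metric.ball (0 : Fin n → ℝ) r × Simp k => (p.1.1, p.2) := by
    fun_prop
  have hj'c : Continuous j' :=
    (((hco.comp hval).subtype_mk _).prodMk continuous_snd).prodMk (hcl.comp hval)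
  have hj' : IsEmbedding j' := by
    refine IsEmbedding.of_comp (g := Prod.map (Prod.map Subtype.val id) id) hj'c (by fun_prop) ?_
    exact hj.comp (IsEmbedding.subtypeVal.prodMap IsEmbedding.id)
  have hF : IsOpenEmbedding (overMap F (Metric.ball 0 r)) :=
    h.isOpenEmbedding.comp ((IsOpenEmbedding.inclusion hrU
      (Metric.isOpen_ball.preimage continuous_subtype_val)).prodMap .id)
  have hmul : IsOpenEmbedding fun c : ℝ => a * c :=
    (Homeomorph.mulLeft₀ a (by rintro rfl; simp at ha2)).isOpenEmbedding
  have hΦ : IsOpenEmbedding Φ := hF.prodMap hmul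
  -- `F × a` restricts to `insertSlab e a w F`
  have hpair : ∀ (x : Metric.ball (0 : Fin n → ℝ) r) (t : Simp k),
      IsSlabPair (w t) (F (collapse e (w t) x, t) e) (a * clampCoord e (w t) x) := fun x t =>
    (isSlabPair_collapse e (hw0 t) x.1).mul ha (hsign _ (hmem x t) t)
  have hcomm : j ∘ overMap (GermSpace.insertSlab e a w F) (Metric.ball 0 r) = Φ ∘ j' := by
    funext ⟨x, t⟩
    exact Prod.ext (Prod.ext (hpair x t).collapse_add rfl) (hpair x t).clampCoord_add
  have hcont : Continuous (overMap (GermSpace.insertSlab e a w F) (Metric.ball 0 r)) := by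
    rw [hj.continuous_iff, hcomm]
    exact hΦ.continuous.comp hj'c
  have hemb : IsEmbedding (overMap (GermSpace.insertSlab e a w F) (Metric.ball 0 r)) := by
    refine IsEmbedding.of_comp hcont hj.continuous ?_
    rw [hcomm]
    exact hΦ.isEmbedding.comp hj'
  refine ⟨Metric.isOpen_ball, Metric.mem_ball_self hr, ⟨hemb, ?_⟩, ?_⟩
  · -- the range is the preimage under `j` of an open set
    have hG : IsOpen ((fun q : (Metric.ball (0 : Fin n → ℝ) r × Simp k) × ℝ =>
        (q.1.1.1 + Pi.single e q.2 : Fin n → ℝ)) ⁻¹' Metric.ball 0 r) := by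
      refine Metric.isOpen_ball.preimage ?_
      exact (continuous_subtype_val.comp (continuous_fst.comp continuous_fst)).add
        ((continuous_single e).comp continuous_snd)
    convert (hΦ.isOpenMap _ hG).preimage hj.continuous using 1
    ext ⟨y, t⟩
    constructor
    · rintro ⟨p, hp⟩
      refine ⟨j' p, ?_, ?_⟩
      · rw [mem_preimage, collapse_add_single]
        exact p.1.2
      · rw [← hp]
        exact (congrFun hcomm p).symm
    · rintro ⟨⟨⟨u, t'⟩, c⟩, hq, hqy⟩
      obtain ⟨h12, h3 : a * c = clampCoord e (w t) y⟩ := Prod.ext_iff.1 hqy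
      obtain ⟨h1 : F (u.1, t') = collapse e (w t) y, h2⟩ := Prod.ext_iff.1 h12
      obtain rfl : t' = t := h2
      have hp : IsSlabPair (w t') (u.1 e) c := by
        have hs : SignType.sign (u.1 e) = SignType.sign (a * F (u.1, t') e) := by
          rw [sign_mul, hsign _ u.2 t', ← sign_mul, ← mul_assoc, ha2, one_mul]
        have := isSlabPair_collapse e (hw0 t') y
        rw [← h1] at this
        have := this.mul ha hs
        rwa [← h3, ← mul_assoc, ha2, one_mul] at this
      obtain ⟨x, hx⟩ : ∃ x : Metric.ball (0 : Fin n → ℝ) r, x.1 = u.1 + Pi.single e c :=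
        ⟨⟨_, hq⟩, rfl⟩
      have hy : GermSpace.insertSlab e a w F (x.1, t') = y := by
        rw [GermSpace.insertSlab, hx, hp.collapse_add, hp.clampCoord_add, h1, h3,
          collapse_add_single]
      rw [← hy]
      exact mem_range_self (f := overMap (GermSpace.insertSlab e a w F) (Metric.ball 0 r)) (x, t')
  · intro x hx hx0 t
    have h0 : x e = 0 := (mem_subspace_iff he).1 hx0
    have hc : clampCoord e (w t) x = x e := clampCoord_of_abs_le (by simpa [h0] using hw0 t)
    simp [GermSpace.insertSlab, collapse, hc, h0, h.fixes x (hrU hx) hx0 t]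

/-! ### Piecewise linearity -/

theorem isPolyhedron_setOf_le {V : Type*} [AddCommGroup V] [Module ℝ V] (f g : V →ₗ[ℝ] ℝ) :
    IsPolyhedron {v | f v ≤ g v} := by
  refine ⟨{(f - g, 0)}, finite_singleton _, ?_⟩
  ext v
  simp

theorem isPolyhedron_closedBall (n : ℕ) {ρ : ℝ} (hρ : 0 ≤ ρ) :
    IsPolyhedron (Metric.closedBall (0 : Fin n → ℝ) ρ) := by
  refine ⟨range (fun i => (LinearMap.proj i, ρ)) ∪ range (fun i => (-LinearMap.proj i, ρ)),
    (finite_range _).union (finite_range _), ?_⟩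
  ext v
  simp only [mem_closedBall_zero_iff, pi_norm_le_iff_of_nonneg hρ, Real.norm_eq_abs, abs_le,
    mem_ofPred_eq, mem_union, mem_range]
  constructor
  · rintro h q (⟨i, rfl⟩ | ⟨i, rfl⟩)
    · simpa using (h i).2
    · simpa using neg_le.1 (h i).1
  · intro h i
    constructor
    · have := h _ (.inr ⟨i, rfl⟩)
      simp only [LinearMap.neg_apply, LinearMap.proj_apply] at this
      linarith
    · simpa using h _ (.inl ⟨i, rfl⟩)

/-- Where the linear function `W` is non-negative, `(x, t) ↦ clampCoord e (W t) x` is linear on each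
of finitely many polyhedra that cover the space. -/
theorem exists_linear_pieces_clampCoord {n k : ℕ} (e : Fin n) (W : (Fin k → ℝ) →ₗ[ℝ] ℝ) :
    ∃ B : Set (((Fin n → ℝ) × (Fin k → ℝ) →ₗ[ℝ] ℝ) × Set ((Fin n → ℝ) × (Fin k → ℝ))),
      B.Finite ∧
      (∀ b ∈ B, IsPolyhedron b.2 ∧
        ∀ q ∈ b.2, 0 ≤ W q.2 → clampCoord e (W q.2) q.1 = b.1 q) ∧
      ∀ q, ∃ b ∈ B, q ∈ b.2 := by
  let w : (Fin n → ℝ) × (Fin k → ℝ) →ₗ[ℝ] ℝ := W ∘ₗ LinearMap.snd ℝ _ _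
  let y : (Fin n → ℝ) × (Fin k → ℝ) →ₗ[ℝ] ℝ := LinearMap.proj e ∘ₗ LinearMap.fst ℝ _ _
  refine ⟨{(w, {q | w q ≤ y q}), (y, {q | y q ≤ w q} ∩ {q | (-w) q ≤ y q}),
    (-w, {q | y q ≤ (-w) q})}, by simp, ?_, ?_⟩
  · rintro _ (rfl | rfl | rfl)
    · refine ⟨isPolyhedron_setOf_le _ _, fun q (hq : W q.2 ≤ q.1 e) h0 => ?_⟩
      rw [clampCoord, min_eq_left hq, max_eq_right (by linarith)]
      rfl
    · refine ⟨(isPolyhedron_setOf_le _ _).inter (isPolyhedron_setOf_le _ _), ?_⟩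
      rintro q ⟨hq1 : q.1 e ≤ W q.2, hq2 : -W q.2 ≤ q.1 e⟩ h0
      exact clampCoord_of_abs_le (abs_le.2 ⟨hq2, hq1⟩)
    · refine ⟨isPolyhedron_setOf_le _ _, fun q (hq : q.1 e ≤ -W q.2) h0 => ?_⟩
      rw [clampCoord, min_eq_right (by linarith), max_eq_left hq]
      rfl
  · intro q
    rcases le_total (w q) (y q) with h | h
    · exact ⟨_, .inl rfl, h⟩
    · rcases le_total ((-w) q) (y q) with h' | h'
      · exact ⟨_, .inr (.inl rfl), h, h'⟩
      · exact ⟨_, .inr (.inr rfl), h'⟩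

/-- Inserting a slab of linearly varying width preserves piecewise linearity. -/
theorem isPL_insertSlab {n k : ℕ} {F : (Fin n → ℝ) × Simp k → (Fin n → ℝ)}
    {U : Set (Fin n → ℝ)} (h : IsPL (ambientMap F U)) (e : Fin n) (a : ℝ) {r : ℝ}
    (hrU : Metric.ball 0 r ⊆ U) (W : (Fin (k + 1) → ℝ) →ₗ[ℝ] ℝ) (hW : ∀ t : Simp k, 0 ≤ W t.1) :
    IsPL (ambientMap (insertSlab e a (fun t => W t.1) F) (Metric.ball 0 r)) := by
  intro p
  have hmem : ∀ q : (Metric.ball (0 : Fin n → ℝ) r ×ˢ stdSimplex ℝ (Fin (k + 1)) :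
      Set ((Fin n → ℝ) × (Fin (k + 1) → ℝ))),
      collapse e (W q.1.2) q.1.1 ∈ Metric.ball (0 : Fin n → ℝ) r := by
    rintro ⟨q, hq1, hq2⟩
    rw [mem_ball_zero_iff] at hq1 ⊢
    exact (norm_collapse_le e (hW ⟨q.2, hq2⟩) q.1).trans_lt hq1
  let Φ : (Metric.ball (0 : Fin n → ℝ) r ×ˢ stdSimplex ℝ (Fin (k + 1)) :
        Set ((Fin n → ℝ) × (Fin (k + 1) → ℝ))) →
      (U ×ˢ stdSimplex ℝ (Fin (k + 1)) : Set ((Fin n → ℝ) × (Fin (k + 1) → ℝ))) :=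
    fun q => ⟨(collapse e (W q.1.2) q.1.1, q.1.2), hrU (hmem q), q.2.2⟩
  have hWc : Continuous W := W.continuous_of_finiteDimensional
  have hΦ : Continuous Φ := by
    have h1 : Continuous fun t : Simp k => W t.1 := hWc.comp continuous_subtype_val
    have h2 : Continuous fun q : (Metric.ball (0 : Fin n → ℝ) r ×ˢ stdSimplex ℝ (Fin (k + 1)) :
        Set ((Fin n → ℝ) × (Fin (k + 1) → ℝ))) => (q.1.1, (⟨q.1.2, q.2.2⟩ : Simp k)) := by
      fun_prop
    exact Continuous.subtype_mk (((continuous_collapse e h1).comp h2).prodMk (by fun_prop)) _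
  obtain ⟨C, hC, hP, hn⟩ := h (Φ p)
  obtain ⟨B, hB, hBP, hBcov⟩ := exists_linear_pieces_clampCoord e W
  -- a closed ball, hence a polyhedron, inside the open ball and around the point
  obtain ⟨ρ, hpρ, hρr⟩ := exists_between (mem_ball_zero_iff.1 p.2.1)
  let Q : Set ((Fin n → ℝ) × (Fin (k + 1) → ℝ)) :=
    LinearMap.fst ℝ (Fin n → ℝ) (Fin (k + 1) → ℝ) ⁻¹' Metric.closedBall 0 ρ ∩
      LinearMap.snd ℝ (Fin n → ℝ) (Fin (k + 1) → ℝ) ⁻¹' stdSimplex ℝ (Fin (k + 1))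
  have hQ : IsPolyhedron Q :=
    ((isPolyhedron_closedBall n ((norm_nonneg _).trans hpρ.le)).preimage _).inter
      ((isPolyhedron_stdSimplex k).preimage _)
  let S : ((Fin n → ℝ) × (Fin (k + 1) → ℝ) →ₗ[ℝ] ℝ) →
      ((Fin n → ℝ) × (Fin (k + 1) → ℝ) →ₗ[ℝ] (Fin n → ℝ)) :=
    fun c => LinearMap.single ℝ (fun _ : Fin n => ℝ) e ∘ₗ c
  let L : ((Fin n → ℝ) × (Fin (k + 1) → ℝ) →ₗ[ℝ] ℝ) →
      ((Fin n → ℝ) × (Fin (k + 1) → ℝ) →ₗ[ℝ] (Fin n → ℝ) × (Fin (k + 1) → ℝ)) :=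
    fun c => (LinearMap.fst ℝ _ _ - S c).prod (LinearMap.snd ℝ _ _)
  have hL : ∀ b ∈ B, ∀ q : (Metric.ball (0 : Fin n → ℝ) r ×ˢ stdSimplex ℝ (Fin (k + 1)) :
      Set ((Fin n → ℝ) × (Fin (k + 1) → ℝ))), q.1 ∈ b.2 → L b.1 q.1 = (Φ q).1 := by
    intro b hb q hq
    refine Prod.ext ?_ rfl
    change q.1.1 - Pi.single e (b.1 q.1) = q.1.1 - Pi.single e (clampCoord e (W q.1.2) q.1.1)
    rw [(hBP b hb).2 q.1 hq (hW ⟨q.1.2, q.2.2⟩)]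
  refine ⟨image2 (fun b P => L b.1 ⁻¹' P ∩ b.2 ∩ Q) B C, hB.image2 _ hC, ?_, ?_⟩
  · rintro _ ⟨b, hb, P, hPC, rfl⟩
    obtain ⟨hp, -, A, hA⟩ := hP P hPC
    refine ⟨((hp.preimage _).inter (hBP b hb).1).inter hQ, ?_,
      A.comp (L b.1).toAffineMap + (a • S b.1).toAffineMap, ?_⟩
    · rintro v ⟨-, hv1, hv2⟩
      exact ⟨Metric.closedBall_subset_ball hρr hv1, hv2⟩
    · rintro q ⟨⟨hq1, hq2⟩, -⟩
      have h1 : (Φ q).1 ∈ P := by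
        rw [← hL b hb q hq2]
        exact hq1
      have h2 : F (collapse e (W q.1.2) q.1.1, ⟨q.1.2, q.2.2⟩) = A (L b.1 q.1) := by
        rw [hL b hb q hq2]
        exact hA (Φ q) h1
      have h3 := (hBP b hb).2 q.1 hq2 (hW ⟨q.1.2, q.2.2⟩)
      change F (collapse e (W q.1.2) q.1.1, ⟨q.1.2, q.2.2⟩) +
        Pi.single e (a * clampCoord e (W q.1.2) q.1.1) = A (L b.1 q.1) + a • Pi.single e (b.1 q.1)
      rw [h2, h3, ← Pi.single_smul, smul_eq_mul]
  · have hball : {q : (Metric.ball (0 : Fin n → ℝ) r ×ˢ stdSimplex ℝ (Fin (k + 1)) :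
        Set ((Fin n → ℝ) × (Fin (k + 1) → ℝ))) | ‖q.1.1‖ < ρ} ∈ 𝓝 p :=
      (isOpen_lt (by fun_prop) continuous_const).mem_nhds hpρ
    filter_upwards [hΦ.continuousAt.preimage_mem_nhds hn, hball] with q hq hqρ
    obtain ⟨P, hPC, hqP⟩ := hq
    obtain ⟨b, hb, hqb⟩ := hBcov q.1
    refine ⟨_, ⟨b, hb, P, hPC, rfl⟩, ⟨?_, hqb⟩, ?_, q.2.2⟩
    · rw [mem_preimage, hL b hb q hqb]
      exact hqP
    · exact mem_closedBall_zero_iff.2 (le_of_lt hqρ)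

/-- The family `(x, t) ↦ A x` for a linear map `A` is piecewise linear. -/
theorem isPL_ambientMap_linear {n : ℕ} (k : ℕ) (A : (Fin n → ℝ) →ₗ[ℝ] (Fin n → ℝ)) :
    IsPL (ambientMap (fun p : (Fin n → ℝ) × Simp k => A p.1) univ) := by
  intro p
  refine ⟨{LinearMap.snd ℝ (Fin n → ℝ) (Fin (k + 1) → ℝ) ⁻¹' stdSimplex ℝ (Fin (k + 1))},
    finite_singleton _, ?_, ?_⟩
  · rintro _ rfl
    exact ⟨(isPolyhedron_stdSimplex k).preimage _, fun v hv => ⟨mem_univ _, hv⟩,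
      (A ∘ₗ LinearMap.fst ℝ _ _).toAffineMap, fun q _ => rfl⟩
  · exact univ_mem' fun q => ⟨_, rfl, q.2.2⟩

/-! ### Germs -/

theorem eventually_nearZero {n k : ℕ} {p : (Fin n → ℝ) × Simp k → Prop} :
    (∀ᶠ q in nearZero n k, p q) ↔ ∀ᶠ x in 𝓝 (0 : Fin n → ℝ), ∀ t, p (x, t) := by
  rw [nearZero, ← principal_univ, eventually_prod_principal_iff]
  simp

/-- The germ `g` multiplies the sign of the coordinate `x_e` by the sign of `a`. -/
def HasSign {n k : ℕ} (e : Fin n) (a : ℝ) (g : ParamGerm n k) : Prop :=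
  g.map (fun y => SignType.sign (y e)) =
    ((fun p => SignType.sign (a * p.1 e) : (Fin n → ℝ) × Simp k → SignType) :
      Germ (nearZero n k) SignType)

theorem hasSign_coe {n k : ℕ} {e : Fin n} {a : ℝ} {F : (Fin n → ℝ) × Simp k → (Fin n → ℝ)} :
    HasSign e a (F : ParamGerm n k) ↔
      ∀ᶠ x in 𝓝 (0 : Fin n → ℝ), ∀ t, SignType.sign (F (x, t) e) = SignType.sign (a * x e) := by
  rw [HasSign, Germ.map_coe, Germ.coe_eq, EventuallyEq, eventually_nearZero]
  rfl

theorem HasSign.restrict {n k l : ℕ} {e : Fin n} {a : ℝ} {g : ParamGerm n k} (h : HasSign e a g)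
    (θ : Fin (l + 1) → Fin (k + 1)) : HasSign e a (restrict θ g) := by
  induction g using Germ.inductionOn with
  | _ F =>
    rw [hasSign_coe] at h
    refine hasSign_coe.2 ?_
    filter_upwards [h] with x hx t
    exact hx _

/-- The sign of a germ can be read off at one parameter for each `x`, which may depend on `x`. -/
theorem HasSign.sign_eq {n k : ℕ} {e : Fin n} {a b : ℝ} {F : (Fin n → ℝ) × Simp k → (Fin n → ℝ)}
    (hF : ∀ᶠ x in 𝓝 (0 : Fin n → ℝ), ∃ t, SignType.sign (F (x, t) e) = SignType.sign (b * x e))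
    (h : HasSign e a (F : ParamGerm n k)) : SignType.sign a = SignType.sign b := by
  obtain ⟨x, ⟨h1, t, h2⟩, h3⟩ : ∃ x : Fin n → ℝ,
      ((∀ t, SignType.sign (F (x, t) e) = SignType.sign (a * x e)) ∧
        ∃ t, SignType.sign (F (x, t) e) = SignType.sign (b * x e)) ∧ 0 < x e := by
    have hc : Tendsto (fun s : ℝ => (Pi.single e s : Fin n → ℝ)) (𝓝[>] 0) (𝓝 0) := by
      have := (continuous_single (A := fun _ : Fin n => ℝ) e).tendsto 0
      rw [Pi.single_zero] at this
      exact this.mono_left nhdsWithin_le_nhds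
    obtain ⟨s, hs, hs0⟩ := ((hc.eventually ((hasSign_coe.1 h).and hF)).and
      self_mem_nhdsWithin).exists
    exact ⟨_, hs, by simpa using hs0⟩
  have := (h1 t).symm.trans h2
  simpa [sign_mul, sign_pos h3] using this

theorem HasSign.unique {n k : ℕ} {e : Fin n} {a b : ℝ} {g : ParamGerm n k}
    (ha : HasSign e a g) (hb : HasSign e b g) : SignType.sign a = SignType.sign b := by
  induction g using Germ.inductionOn with
  | _ F =>
    exact ha.sign_eq ((hasSign_coe.1 hb).mono fun x hx => ⟨stdSimplex.vertex 0, hx _⟩)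

theorem IsTopGerm.exists_hasSign {n k : ℕ} {g : ParamGerm n k} (hg : IsTopGerm n (n - 1) k g)
    {e : Fin n} (he : e.val + 1 = n) : ∃ a : ℝ, (a = 1 ∨ a = -1) ∧ HasSign e a g := by
  obtain ⟨F, U, rfl, h⟩ := hg
  obtain ⟨a, ha, r, hr, -, hs⟩ := h.exists_sign he
  exact ⟨a, ha, hasSign_coe.2 (eventually_of_mem (Metric.ball_mem_nhds 0 hr) hs)⟩

/-- The total weight of the vertices of `Δᵏ` that `s` sends to `0`, as a linear function. -/
noncomputable def weightLinear {k : ℕ} (s : Fin (k + 1) → Fin 2) : (Fin (k + 1) → ℝ) →ₗ[ℝ] ℝ :=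
  LinearMap.proj 0 ∘ₗ FunOnFinite.linearMap ℝ ℝ s

/-- The affine function `Δᵏ → [0, 1]` that is `1` on the vertices sent to `0` by `s`, and `0` on
those sent to `1`. -/
noncomputable def weight {k : ℕ} (s : Fin (k + 1) → Fin 2) (t : Simp k) : ℝ := weightLinear s t.1

theorem weight_nonneg {k : ℕ} (s : Fin (k + 1) → Fin 2) (t : Simp k) : 0 ≤ weight s t :=
  (stdSimplex.map s t).2.1 0

theorem continuous_weight {k : ℕ} (s : Fin (k + 1) → Fin 2) : Continuous (weight s) :=
  (LinearMap.continuous_of_finiteDimensional _).comp continuous_subtype_val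

theorem weight_comp {k l : ℕ} (s : Fin (k + 1) → Fin 2) (θ : Fin (l + 1) → Fin (k + 1))
    (t : Simp l) : weight (s ∘ θ) t = weight s (stdSimplex.map θ t) :=
  congrArg (fun v : Simp 1 => v.1 0) (stdSimplex.map_comp_apply θ s t).symm

theorem weight_const_zero {k : ℕ} (t : Simp k) : weight (fun _ => 0) t = 1 := by
  simp [weight, weightLinear, FunOnFinite.linearMap_apply_apply, t.2.2]

theorem weight_const_one {k : ℕ} (t : Simp k) : weight (fun _ => 1) t = 0 := by
  simp [weight, weightLinear, FunOnFinite.linearMap_apply_apply]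

theorem tendsto_collapse {n k : ℕ} (e : Fin n) (s : Fin (k + 1) → Fin 2) :
    Tendsto (fun p : (Fin n → ℝ) × Simp k => (collapse e (weight s p.2) p.1, p.2))
      (nearZero n k) (nearZero n k) := by
  refine Tendsto.prodMk ?_ tendsto_snd
  rw [tendsto_zero_iff_norm_tendsto_zero]
  refine squeeze_zero (fun _ => norm_nonneg _) (fun p => norm_collapse_le e (weight_nonneg s p.2) _)
    ?_
  exact tendsto_norm_zero.comp tendsto_fst

/-- The operation `insertSlab` on germs, with the width of the slab given by the affine function
`weight s` on the simplex. -/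
noncomputable def slabGerm {n k : ℕ} (e : Fin n) (a : ℝ) (s : Fin (k + 1) → Fin 2)
    (g : ParamGerm n k) : ParamGerm n k :=
  g.compTendsto _ (tendsto_collapse e s) +
    ((fun p => Pi.single e (a * clampCoord e (weight s p.2) p.1) :
      (Fin n → ℝ) × Simp k → (Fin n → ℝ)) : ParamGerm n k)

theorem slabGerm_coe {n k : ℕ} (e : Fin n) (a : ℝ) (s : Fin (k + 1) → Fin 2)
    (F : (Fin n → ℝ) × Simp k → (Fin n → ℝ)) :
    slabGerm e a s (F : ParamGerm n k) = (insertSlab e a (weight s) F : ParamGerm n k) := rfl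

theorem restrict_slabGerm {n k l : ℕ} (e : Fin n) (a : ℝ) (s : Fin (k + 1) → Fin 2)
    (g : ParamGerm n k) (θ : Fin (l + 1) → Fin (k + 1)) :
    restrict θ (slabGerm e a s g) = slabGerm e a (s ∘ θ) (restrict θ g) := by
  induction g using Germ.inductionOn with
  | _ F =>
    refine congrArg (fun G : (Fin n → ℝ) × Simp l → (Fin n → ℝ) => (G : ParamGerm n l)) ?_
    funext p
    simp [baseChange, weight_comp]

theorem HasSign.exists_ball {n m k : ℕ} {e : Fin n} {a : ℝ}
    {F : (Fin n → ℝ) × Simp k → (Fin n → ℝ)} {U : Set (Fin n → ℝ)}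
    (hs : HasSign e a (F : ParamGerm n k)) (h : IsLocalHomeoOn n m k F U) :
    ∃ r > 0, Metric.ball 0 r ⊆ U ∧
      ∀ x ∈ Metric.ball 0 r, ∀ t, SignType.sign (F (x, t) e) = SignType.sign (a * x e) := by
  obtain ⟨r, hr, hsub⟩ := Metric.eventually_nhds_iff_ball.1
    ((h.isOpen.eventually_mem h.zero_mem).and (hasSign_coe.1 hs))
  exact ⟨r, hr, fun x hx => (hsub x hx).1, fun x hx => (hsub x hx).2⟩

theorem IsTopGerm.slabGerm {n k : ℕ} {e : Fin n} (he : e.val + 1 = n) {a : ℝ}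
    (ha : a = 1 ∨ a = -1) (s : Fin (k + 1) → Fin 2) {g : ParamGerm n k}
    (hg : IsTopGerm n (n - 1) k g) (hs : HasSign e a g) :
    IsTopGerm n (n - 1) k (slabGerm e a s g) := by
  obtain ⟨F, U, rfl, h⟩ := hg
  obtain ⟨r, hr, hrU, hsign⟩ := hs.exists_ball h
  exact ⟨_, _, slabGerm_coe e a s F,
    h.insertSlab he ha hr hrU hsign (continuous_weight s) (weight_nonneg s)⟩

theorem IsPLGerm.slabGerm {n k : ℕ} {e : Fin n} (he : e.val + 1 = n) {a : ℝ}
    (ha : a = 1 ∨ a = -1) (s : Fin (k + 1) → Fin 2) {g : ParamGerm n k}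
    (hg : IsPLGerm n (n - 1) k g) (hs : HasSign e a g) :
    IsPLGerm n (n - 1) k (slabGerm e a s g) := by
  obtain ⟨F, U, rfl, h, hpl⟩ := hg
  obtain ⟨r, hr, hrU, hsign⟩ := hs.exists_ball h
  exact ⟨_, _, slabGerm_coe e a s F,
    h.insertSlab he ha hr hrU hsign (continuous_weight s) (weight_nonneg s),
    isPL_insertSlab hpl e a hrU (weightLinear s) (weight_nonneg s)⟩

theorem slabGerm_const_one {n k : ℕ} (e : Fin n) (a : ℝ) (g : ParamGerm n k) :
    slabGerm e a (fun _ => 1) g = g := by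
  induction g using Germ.inductionOn with
  | _ F =>
    refine congrArg (fun G : (Fin n → ℝ) × Simp k → (Fin n → ℝ) => (G : ParamGerm n k)) ?_
    funext p
    have h : Pi.single e (clampCoord e 0 p.1) = (0 : Fin n → ℝ) := by
      simpa [collapse_zero] using collapse_add_single e 0 p.1
    have h' : clampCoord e 0 p.1 = 0 := by simpa using congrFun h e
    simp [weight_const_one, collapse_zero, h']

/-- At width `1`, the germ is that of `a` acting on the last coordinate, since `g` fixes the
hyperplane. -/
theorem IsTopGerm.slabGerm_const_zero {n k : ℕ} {g : ParamGerm n k} (hg : IsTopGerm n (n - 1) k g)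
    {e : Fin n} (he : e.val + 1 = n) (a : Matrix.orthogonalGroup (Fin 1) ℝ) :
    GermSpace.slabGerm e (a.1 0 0) (fun _ => 0) g =
      ((fun p => actLast n a p.1 : (Fin n → ℝ) × Simp k → (Fin n → ℝ)) : ParamGerm n k) := by
  obtain ⟨F, U, rfl, h⟩ := hg
  rw [slabGerm_coe, Germ.coe_eq, EventuallyEq, eventually_nearZero]
  obtain ⟨r, hr, hrU⟩ := Metric.isOpen_iff.1 h.isOpen 0 h.zero_mem
  filter_upwards [Metric.ball_mem_nhds _ (lt_min hr one_pos)] with x hx t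
  rw [mem_ball_zero_iff, lt_min_iff] at hx
  have hc : clampCoord e 1 x = x e :=
    clampCoord_of_abs_le ((norm_le_pi_norm x e).trans hx.2.le)
  have h0 : collapse e 1 x e = 0 := by rw [collapse_apply, hc, sub_self]
  have hU : collapse e 1 x ∈ U :=
    hrU (mem_ball_zero_iff.2 ((norm_collapse_le e zero_le_one x).trans_lt hx.1))
  rw [GermSpace.insertSlab, weight_const_zero, h.fixes _ hU ((mem_subspace_iff he).2 h0), hc]
  funext i
  rcases eq_or_ne i e with rfl | hi
  · simp [h0, actLast, he]
  · have : ¬ i.val + 1 = n := fun h => hi (Fin.ext (by omega))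
    simp [collapse, actLast, hi, this]

/-! ### The retraction onto `O₁` and the deformation -/

theorem orthogonalGroup_one_apply (a : Matrix.orthogonalGroup (Fin 1) ℝ) :
    a.1 0 0 = 1 ∨ a.1 0 0 = -1 := by
  have := congrFun (congrFun ((Matrix.mem_orthogonalGroup_iff _ _).1 a.2) 0) 0
  exact mul_self_eq_one_iff.1 (by simpa [Matrix.mul_apply] using this)

theorem orthogonalGroup_one_ext {a b : Matrix.orthogonalGroup (Fin 1) ℝ}
    (h : SignType.sign (a.1 0 0) = SignType.sign (b.1 0 0)) : a = b := by
  refine Subtype.ext (Matrix.ext fun i j => ?_)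
  rw [Subsingleton.elim i 0, Subsingleton.elim j 0]
  rcases orthogonalGroup_one_apply a with ha | ha <;>
    rcases orthogonalGroup_one_apply b with hb | hb <;> simp [ha, hb] at h ⊢

theorem IsTopGerm.exists_hasSign_orthogonal {n k : ℕ} {g : ParamGerm n k}
    (hg : IsTopGerm n (n - 1) k g) {e : Fin n} (he : e.val + 1 = n) :
    ∃ a : Matrix.orthogonalGroup (Fin 1) ℝ, HasSign e (a.1 0 0) g := by
  obtain ⟨a, ha, h⟩ := hg.exists_hasSign he
  refine ⟨⟨Matrix.of fun _ _ => a, (Matrix.mem_orthogonalGroup_iff _ _).2 ?_⟩, h⟩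
  ext i j
  rw [Subsingleton.elim i 0, Subsingleton.elim j 0]
  rcases ha with rfl | rfl <;> simp [Matrix.mul_apply]

/-- The element of `O(1)` by which a simplex of `TOP_{n,n-1}` acts on the sides of the
hyperplane. -/
noncomputable def signOf {n k : ℕ} {e : Fin n} (he : e.val + 1 = n) {g : ParamGerm n k}
    (hg : IsTopGerm n (n - 1) k g) : Matrix.orthogonalGroup (Fin 1) ℝ :=
  (hg.exists_hasSign_orthogonal he).choose

theorem hasSign_signOf {n k : ℕ} {e : Fin n} (he : e.val + 1 = n) {g : ParamGerm n k}
    (hg : IsTopGerm n (n - 1) k g) : HasSign e ((signOf he hg).1 0 0) g :=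
  (hg.exists_hasSign_orthogonal he).choose_spec

theorem signOf_restrict {n k l : ℕ} {e : Fin n} (he : e.val + 1 = n) {g : ParamGerm n k}
    (hg : IsTopGerm n (n - 1) k g) (θ : Fin (l + 1) → Fin (k + 1))
    (hg' : IsTopGerm n (n - 1) l (restrict θ g)) : signOf he hg' = signOf he hg :=
  orthogonalGroup_one_ext
    ((hasSign_signOf he hg').unique ((hasSign_signOf he hg).restrict θ))

theorem signOf_actFamily {n k : ℕ} {e : Fin n} (he : e.val + 1 = n)
    (σ : C(Simp k, Matrix.orthogonalGroup (Fin 1) ℝ))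
    (hσ : IsTopGerm n (n - 1) k (actFamily n σ : ParamGerm n k)) (t : Simp k) :
    signOf he hσ = σ t :=
  orthogonalGroup_one_ext ((hasSign_signOf he hσ).sign_eq
    (Eventually.of_forall fun x => ⟨t, by simp [actFamily, actLast, he]⟩))

/-- The map `TOP_{n,n-1} → O₁` that sends a germ to the constant singular simplex at its sign. -/
noncomputable def TOPtoO1 {n : ℕ} {e : Fin n} (he : e.val + 1 = n) : TOP n (n - 1) ⟶ O1 where
  app k := ↾fun g => (TopCat.toSSetObjEquiv _ k).symm (ContinuousMap.const _ (signOf he g.2))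
  naturality k l θ := by
    ext g
    refine (TopCat.toSSetObjEquiv _ l).injective (ContinuousMap.ext fun t => ?_)
    exact signOf_restrict he g.2 θ.unop.toOrderHom ((TOP n (n - 1)).map θ g).2

theorem O1toTOP_comp_TOPtoO1 {n : ℕ} {e : Fin n} (he : e.val + 1 = n) :
    O1toTOP n ≫ TOPtoO1 he = 𝟙 O1 := by
  ext k σ
  refine (TopCat.toSSetObjEquiv _ k).injective (ContinuousMap.ext fun t => ?_)
  exact signOf_actFamily he _ ((O1toTOP n).app k σ).2 t

open MonoidalCategory Simplicial

/-- The deformation of `TOP_{n,n-1}` onto `O₁`: it inserts at the hyperplane a slab on which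
the germ is the identity or the reflection. -/
noncomputable def deformation {n : ℕ} {e : Fin n} (he : e.val + 1 = n) :
    TOP n (n - 1) ⊗ Δ[1] ⟶ TOP n (n - 1) where
  app k := ↾fun p => ⟨slabGerm e ((signOf he p.1.2).1 0 0)
      (SSet.stdSimplex.objEquiv p.2).toOrderHom p.1.1,
    p.1.2.slabGerm he (orthogonalGroup_one_apply _) _ (hasSign_signOf he p.1.2)⟩
  naturality k l θ := by
    ext p
    refine Subtype.ext (Eq.trans ?_ (restrict_slabGerm e _ _ _ θ.unop.toOrderHom).symm)
    exact congrArg (fun a : Matrix.orthogonalGroup (Fin 1) ℝ => slabGerm e (a.1 0 0) _ _)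
      (signOf_restrict he p.1.2 θ.unop.toOrderHom _)

theorem ι₀_comp_deformation {n : ℕ} {e : Fin n} (he : e.val + 1 = n) :
    SSet.ι₀ ≫ deformation he = TOPtoO1 he ≫ O1toTOP n := by
  ext k g
  exact Subtype.ext (g.2.slabGerm_const_zero he _)

theorem ι₁_comp_deformation {n : ℕ} {e : Fin n} (he : e.val + 1 = n) :
    SSet.ι₁ ≫ deformation he = 𝟙 _ := by
  ext k g
  exact Subtype.ext (slabGerm_const_one e _ _)

theorem nonempty_homotopy {X Y : SSet.{0}} {f g : X ⟶ Y} (H : X ⊗ Δ[1] ⟶ Y)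
    (h₀ : SSet.ι₀ ≫ H = f) (h₁ : SSet.ι₁ ≫ H = g) : Nonempty (SSet.Homotopy f g) :=
  ⟨{ h := H
     h₀ := h₀
     h₁ := h₁
     rel := by
      ext k ⟨x, _⟩
      exact x.2.elim }⟩

/-- A map with a retraction is a homotopy equivalence, if the target deforms onto its image. -/
theorem isHomotopyEquiv_of_deformation {X Y : SSet.{0}} {f : X ⟶ Y} {g : Y ⟶ X}
    (hfg : f ≫ g = 𝟙 X) (H : Y ⊗ Δ[1] ⟶ Y) (h₀ : SSet.ι₀ ≫ H = g ≫ f)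
    (h₁ : SSet.ι₁ ≫ H = 𝟙 Y) : IsHomotopyEquiv f :=
  ⟨g, nonempty_homotopy (SemiCartesianMonoidalCategory.fst _ _) hfg.symm rfl,
    nonempty_homotopy H h₀ h₁⟩

/-! ### The PL subcomplex -/

theorem isPLGerm_actFamily {n k : ℕ} {e : Fin n} (he : e.val + 1 = n)
    (σ : C(Simp k, Matrix.orthogonalGroup (Fin 1) ℝ)) :
    IsPLGerm n (n - 1) k (actFamily n σ : ParamGerm n k) := by
  have hloc := isLocalHomeoOn_actFamily n σ
  refine ⟨_, univ, rfl, hloc, ?_⟩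
  let a := signOf he ⟨_, univ, rfl, hloc⟩
  -- `σ` is constant, as it equals the sign of the germ everywhere
  have hσ : actFamily n σ = fun p => actLast n a p.1 := by
    funext p
    rw [actFamily, ← signOf_actFamily he σ ⟨_, univ, rfl, hloc⟩ p.2]
  let A : (Fin n → ℝ) →ₗ[ℝ] (Fin n → ℝ) :=
    { toFun := actLast n a
      map_add' := fun x y => by
        funext i
        by_cases hi : i.val + 1 = n <;> simp [actLast, hi, mul_add]
      map_smul' := fun c x => by
        funext i
        by_cases hi : i.val + 1 = n <;> simp [actLast, hi, mul_left_comm] }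
  rw [hσ]
  exact isPL_ambientMap_linear k A

/-- The corestriction `O₁ → PL_{n,n-1}` of `O1toTOP`. -/
noncomputable def O1toPL {n : ℕ} {e : Fin n} (he : e.val + 1 = n) :
    O1 ⟶ (PL n (n - 1) : SSet.{0}) :=
  SSet.Subcomplex.lift (O1toTOP n) (by
    rintro k _ ⟨σ, rfl⟩
    exact isPLGerm_actFamily he _)

/-- The deformation of `TOP_{n,n-1}` restricts to `PL_{n,n-1}`. -/
noncomputable def deformationPL {n : ℕ} {e : Fin n} (he : e.val + 1 = n) :
    (PL n (n - 1) : SSet.{0}) ⊗ Δ[1] ⟶ (PL n (n - 1) : SSet.{0}) :=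
  SSet.Subcomplex.lift ((PL n (n - 1)).ι ▷ Δ[1] ≫ deformation he) (by
    rintro k _ ⟨p, rfl⟩
    exact IsPLGerm.slabGerm he (orthogonalGroup_one_apply _) _ p.1.2
      (hasSign_signOf he p.1.1.2))

end GermSpace

theorem lemmal (n : ℕ) (hn : 1 ≤ n) :
    GermSpace.IsHomotopyEquiv (GermSpace.O1toTOP n) ∧
    ∃ j : GermSpace.O1 ⟶ (GermSpace.PL n (n - 1) : SSet.{0}),
      j ≫ (GermSpace.PL n (n - 1)).ι = GermSpace.O1toTOP n ∧ GermSpace.IsHomotopyEquiv j := by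
  have he : (⟨n - 1, by omega⟩ : Fin n).val + 1 = n := Nat.sub_add_cancel hn
  refine ⟨GermSpace.isHomotopyEquiv_of_deformation (GermSpace.O1toTOP_comp_TOPtoO1 he)
    (GermSpace.deformation he) (GermSpace.ι₀_comp_deformation he)
    (GermSpace.ι₁_comp_deformation he), GermSpace.O1toPL he, rfl, ?_⟩
  refine GermSpace.isHomotopyEquiv_of_deformation
    (g := (GermSpace.PL n (n - 1)).ι ≫ GermSpace.TOPtoO1 he)
    (GermSpace.O1toTOP_comp_TOPtoO1 he) (GermSpace.deformationPL he) ?_ ?_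
  · rw [← cancel_mono (GermSpace.PL n (n - 1)).ι]
    exact congrArg ((GermSpace.PL n (n - 1)).ι ≫ ·) (GermSpace.ι₀_comp_deformation he)
  · rw [← cancel_mono (GermSpace.PL n (n - 1)).ι]
    exact congrArg ((GermSpace.PL n (n - 1)).ι ≫ ·) (GermSpace.ι₁_comp_deformation he)
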